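/- Let $h:[0,\infty)\to\mathbb{R}$ be continuous on $[0,\infty)$ and three times differentiable on $(0,\infty)$, with $h(0)=0$, $h(t)\to\infty$ as $t\to\infty$, and $h'(t)>0$, $h''(t)<0$, $h'''(t)>0$ for all $t>0$. Then $h$ is a bijection of $[0,\infty)$ onto itself; let $h^{-1}:[0,\infty)\to[0,\infty)$ be its inverse. Let $Q$ be a cube in $\mathbb{R}^n$ (all cubes have sides parallel to the coordinate axes), and write $\langle f\rangle_J=\frac1{|J|}\int_J f$ for the average of $f$ over $J$ with respect to Lebesgue measure. For real-valued $\varphi\in L^1(Q)$ put $$K_{h,Q}(\varphi)=\sup_{J\subseteq Q}\big\langle h(|\varphi-\langle\varphi\rangle_J|)\big\rangle_J,\qquad \|\varphi\|_{\mathrm{BMO}(Q)}=\sup_{J\subseteq Q}\big\langle|\varphi-\langle\varphi\rangle_J|^2\big\rangle_J^{1/2},$$ the suprema being taken over all subcubes $J$ of $Q$; and say that $\varphi\in\mathrm{BMO}(Q)$ if $\varphi\in L^1(Q)$ and $\sup_{J\subseteq Q}\langle|\varphi-\langle\varphi\rangle_J|\rangle_J<\infty$. If $\varphi\in L^1(Q)$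 satisfies $K_{h,Q}(\varphi)<\infty$, then $\varphi\in\mathrm{BMO}(Q)$, $\|\varphi\|_{\mathrm{BMO}(Q)}<\infty$, and $$h^{-1}\big(K_{h,Q}(\varphi)\big)\le\|\varphi\|_{\mathrm{BMO}(Q)}\le 2^{-n/2-1}\,h^{-1}\big(2^{n+2}K_{h,Q}(\varphi)\big).$$ -/

import Mathlib

open MeasureTheory Set Filter Topology
open scoped ENNReal

/-- `J` is a (closed, nondegenerate) cube in `ℝⁿ` with sides parallel to the coordinate axes:
the product of the intervals `[a i, a i + l]`, with side length `l > 0`. -/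
def IsCube {n : ℕ} (J : Set (Fin n → ℝ)) : Prop :=
  ∃ (a : Fin n → ℝ) (l : ℝ), 0 < l ∧ J = Set.Icc a (fun i => a i + l)

/-- The functional `K_{h,Q}(φ)`: the supremum over all subcubes `J` of `Q` of the average over `J`
of `h (|φ - ⟨φ⟩_J|)`, as an extended nonnegative number. -/
noncomputable def weakOsc {n : ℕ} (h : ℝ → ℝ) (Q : Set (Fin n → ℝ)) (φ : (Fin n → ℝ) → ℝ) :
    ℝ≥0∞ :=
  ⨆ (J : Set (Fin n → ℝ)) (_ : IsCube J) (_ : J ⊆ Q),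
    ⨍⁻ x in J, ENNReal.ofReal (h |φ x - ⨍ y in J, φ y ∂volume|) ∂volume

/-- Membership in `BMO(Q)`: `φ` is integrable on `Q`, and its mean oscillations over the subcubes
of `Q` are bounded. -/
def MemBMO {n : ℕ} (Q : Set (Fin n → ℝ)) (φ : (Fin n → ℝ) → ℝ) : Prop :=
  IntegrableOn φ Q ∧
    (⨆ (J : Set (Fin n → ℝ)) (_ : IsCube J) (_ : J ⊆ Q),
      ⨍⁻ x in J, ENNReal.ofReal |φ x - ⨍ y in J, φ y ∂volume| ∂volume) < ∞

/-- The norm of `BMO(Q)`, defined by quadratic mean oscillations: the supremum over all subcubes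
`J` of `Q` of `⟨|φ - ⟨φ⟩_J|²⟩_J ^ (1/2)`, as an extended nonnegative number. -/
noncomputable def bmoNorm {n : ℕ} (Q : Set (Fin n → ℝ)) (φ : (Fin n → ℝ) → ℝ) : ℝ≥0∞ :=
  ⨆ (J : Set (Fin n → ℝ)) (_ : IsCube J) (_ : J ⊆ Q),
    (⨍⁻ x in J, ENNReal.ofReal (|φ x - ⨍ y in J, φ y ∂volume| ^ 2) ∂volume) ^ (1 / 2 : ℝ)

/-- The inverse function of `h` on `[0, ∞)`: it sends `s` to the `t ≥ 0` with `h t = s`, which is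
meaningful when `h` is a bijection of `[0, ∞)` onto itself and `s ≥ 0`. -/
noncomputable def halfLineInv (h : ℝ → ℝ) : ℝ → ℝ :=
  Function.invFunOn h (Set.Ici 0)

/-!
The left inequality is Jensen's inequality for the concave function `s ↦ h (√s)`
(`IsOscWeight.weakOsc_le`). The right inequality is proved with a Bellman function on the
parabolic strip `x₁ ^ 2 ≤ x₂ ≤ x₁ ^ 2 + δ ^ 2`, where `x = (⟨f⟩_J, ⟨f²⟩_J)`, `ε` bounds the quadratic
oscillation of `f` and `δ = 2 ^ (n / 2) ε`.

Put `c = h (2 δ) / (4 δ ^ 2)`. Concavity of `h` gives `c t ^ 2 ≤ h |t|` for `|t| ≤ 2 δ`, and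
convexity of `t ↦ h t / t`, which follows from `h''' > 0`, gives `A |t| + k t ^ 2 ≤ h |t|` for all `t`,
with equality at `|t| = 2 δ`, for some `k ≤ 0`. The function `bellman`, equal to `c x₂` on the
curvilinear triangle between the tangents `x₂ = 2 δ |x₁|` and the upper parabola and to
`A |x₁| + k x₂` outside it, is convex under every tangent of the upper parabola
(`convexOn_bellman`). When a cube `J` with `⟨f²⟩_J - ⟨f⟩_J ^ 2 ≤ ε ^ 2` is cut into `2 ^ n` equal cubes,
their points all lie under the tangent over `⟨f⟩_J` (`bellman_average_le`), so the average of
`bellman` does not decrease from cubes to their children. This is where the factor `2 ^ (n / 2)`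
comes from.

At small scales `bellman` should be at most `⟨h |f|⟩`. No differentiation theorem is used: for
bounded `f` and a continuous `ψ`, the perturbed inequality `bellman x_J ≤ ⟨h |f| + M |f - ψ|⟩_J` is
elementary on small cubes, propagates to all cubes with the same `M`, and `ψ → f` in `L¹` removes
the perturbation (`IsOscWeight.bellman_le_integral`). At points with `x₂ = x₁ ^ 2 + v` this yields
`c v ≤ ⟨h |f|⟩_J`, for `x₁ ≠ 0` as well (`IsOscWeight.mul_variance_le_integral`). Applied to
truncations of `φ`, recentred at the truncated average of `φ`, it gives
`c ε ^ 2 ≤ K` with `ε` the norm of the truncation, that is, `h (2 δ) ≤ 2 ^ (n + 2) K`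
(`IsOscWeight.map_bmoNorm_truncate_le`). The bound survives the removal of the truncation by
Fatou's lemma (`bmoNorm_le_of_truncate`), and it yields `φ ∈ BMO`.
-/

/-! ### Weights on the half-line -/

/-- The consequences of `h' > 0`, `h'' < 0`, `h''' > 0` that the argument uses: `h` is a
homeomorphism of the half-line onto itself, it lies below its tangents, and `t ↦ h t / t` lies above
its tangents. The last property is multiplied by `t`, so that it bounds `h` from below by a
quadratic polynomial vanishing at `0`, in other words by a linear function of `(t, t ^ 2)`. -/
structure IsOscWeight (h : ℝ → ℝ) : Prop where
  continuousOn : ContinuousOn h (Ici 0)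
  map_zero : h 0 = 0
  tendsto : Tendsto h atTop atTop
  strictMonoOn : StrictMonoOn h (Ici 0)
  concaveOn : ConcaveOn ℝ (Ici 0) h
  exists_le_affine : ∀ s, 0 < s → ∃ m, 0 ≤ m ∧ ∀ t, 0 ≤ t → h t ≤ h s + m * (t - s)
  exists_quadratic_le : ∀ a, 0 < a → ∃ k, k ≤ 0 ∧ ∀ t, 0 ≤ t → t * (h a / a) + k * (t * (t - a)) ≤ h t

/-- A function with convex derivative that vanishes at `0` and to second order at `a > 0` is
nonnegative on `[0, ∞)`: by Rolle the derivative also vanishes at some `ξ` in `(0, a)`, so by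
convexity it is nonpositive on `[ξ, a]` and nonnegative on the rest of `(0, ∞)`. -/
theorem nonneg_of_hasDerivAt_of_convexOn {F F' : ℝ → ℝ} {a : ℝ} (ha : 0 < a)
    (hF : ContinuousOn F (Ici 0)) (hF' : ∀ t, 0 < t → HasDerivAt F (F' t) t)
    (hconv : ConvexOn ℝ (Ioi 0) F') (h0 : F 0 = 0) (h1 : F a = 0) (h2 : F' a = 0)
    {t : ℝ} (ht : 0 ≤ t) : 0 ≤ F t := by
  obtain ⟨ξ, hξ, hξ'⟩ : ∃ ξ ∈ Ioo 0 a, F' ξ = 0 :=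
    exists_hasDerivAt_eq_zero ha (hF.mono Icc_subset_Ici_self) (h0.trans h1.symm)
      (fun x hx => hF' x hx.1)
  have hsub : ∀ {D : Set ℝ}, D ⊆ Ici 0 → ContinuousOn F D := fun hD => hF.mono hD
  rcases le_or_gt t ξ with hle | hlt
  · have hmono : MonotoneOn F (Icc 0 ξ) := by
      refine monotoneOn_of_hasDerivWithinAt_nonneg (f' := F') (convex_Icc _ _)
        (hsub Icc_subset_Ici_self) (fun x hx => ?_) (fun x hx => ?_)
      · rw [interior_Icc] at hx
        exact (hF' x hx.1).hasDerivWithinAt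
      · rw [interior_Icc] at hx
        have := hconv.slope_mono_adjacent (x := x) (y := ξ) (z := a) hx.1 ha hx.2 hξ.2
        rw [hξ', h2] at this
        have hpos : 0 < ξ - x := sub_pos.2 hx.2
        have h3 : (0 - F' x) / (ξ - x) ≤ 0 := by simpa using this
        rw [div_le_iff₀ hpos] at h3
        linarith
    simpa [h0] using hmono ⟨le_rfl, hξ.1.le⟩ ⟨ht, hle⟩ ht
  · rcases le_or_gt t a with hta | hta
    · have hanti : AntitoneOn F (Icc ξ a) := by
        refine antitoneOn_of_hasDerivWithinAt_nonpos (f' := F') (convex_Icc _ _)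
          (hsub fun x hx => hξ.1.le.trans hx.1) (fun x hx => ?_) (fun x hx => ?_)
        · rw [interior_Icc] at hx
          exact (hF' x (hξ.1.trans hx.1)).hasDerivWithinAt
        · rw [interior_Icc] at hx
          have := hconv.le_max_of_mem_Icc (x := ξ) (y := a) (z := x) hξ.1 ha ⟨hx.1.le, hx.2.le⟩
          simpa [hξ', h2] using this
      simpa [h1] using hanti ⟨hlt.le, hta⟩ ⟨hξ.2.le, le_rfl⟩ hta
    · have hmono : MonotoneOn F (Ici a) := by
        refine monotoneOn_of_hasDerivWithinAt_nonneg (f' := F') (convex_Ici _)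
          (hsub (Ici_subset_Ici.2 ha.le)) (fun x hx => ?_) (fun x hx => ?_)
        · rw [interior_Ici] at hx
          exact (hF' x (ha.trans hx)).hasDerivWithinAt
        · rw [interior_Ici] at hx
          have := hconv.slope_mono_adjacent (x := ξ) (y := a) (z := x) hξ.1 (ha.trans hx) hξ.2 hx
          rw [hξ', h2] at this
          have hpos : 0 < x - a := sub_pos.2 hx
          have h3 : 0 ≤ (F' x - 0) / (x - a) := by simpa using this
          rw [le_div_iff₀ hpos] at h3
          linarith
      simpa [h1] using hmono (mem_Ici.2 le_rfl) hta.le hta.le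

theorem isOscWeight_of_deriv {h : ℝ → ℝ}
    (h_cont : ContinuousOn h (Set.Ici 0))
    (h_diff1 : ∀ t : ℝ, 0 < t → DifferentiableAt ℝ h t)
    (h_diff2 : ∀ t : ℝ, 0 < t → DifferentiableAt ℝ (deriv h) t)
    (h_diff3 : ∀ t : ℝ, 0 < t → DifferentiableAt ℝ (deriv (deriv h)) t)
    (h_zero : h 0 = 0)
    (h_lim : Tendsto h atTop atTop)
    (h_deriv1 : ∀ t : ℝ, 0 < t → 0 < deriv h t)
    (h_deriv2 : ∀ t : ℝ, 0 < t → deriv (deriv h) t < 0)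
    (h_deriv3 : ∀ t : ℝ, 0 < t → 0 < deriv (deriv (deriv h)) t) : IsOscWeight h := by
  have hconc : ConcaveOn ℝ (Ici 0) h := by
    refine concaveOn_of_deriv2_nonpos (convex_Ici 0) h_cont ?_ ?_ ?_ <;> rw [interior_Ici]
    · exact fun x hx => (h_diff1 x hx).differentiableWithinAt
    · exact fun x hx => (h_diff2 x hx).differentiableWithinAt
    · exact fun x hx => (h_deriv2 x hx).le
  have hconv : ConvexOn ℝ (Ioi 0) (deriv h) := by
    refine convexOn_of_deriv2_nonneg (convex_Ioi 0)
      (fun x hx => (h_diff2 x hx).continuousAt.continuousWithinAt) ?_ ?_ ?_ <;> rw [interior_Ioi]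
    · exact fun x hx => (h_diff2 x hx).differentiableWithinAt
    · exact fun x hx => (h_diff3 x hx).differentiableWithinAt
    · exact fun x hx => (h_deriv3 x hx).le
  have htan : ∀ s, 0 < s → ∀ t, 0 ≤ t → h t ≤ h s + deriv h s * (t - s) := by
    intro s hs t ht
    rcases lt_trichotomy t s with hts | rfl | hts
    · have := hconc.deriv_le_slope (x := t) (y := s) ht hs.le hts (h_diff1 s hs)
      rw [slope_def_field, le_div_iff₀ (sub_pos.2 hts)] at this
      linarith
    · simp
    · have := hconc.slope_le_deriv (x := s) (y := t) hs.le ht hts (h_diff1 s hs)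
      rw [slope_def_field, div_le_iff₀ (sub_pos.2 hts)] at this
      linarith
  refine ⟨h_cont, h_zero, h_lim, ?_, hconc, fun s hs => ⟨_, (h_deriv1 s hs).le, htan s hs⟩, ?_⟩
  · refine strictMonoOn_of_deriv_pos (convex_Ici 0) h_cont ?_
    rw [interior_Ici]
    exact h_deriv1
  · intro a ha
    have ha' := htan a ha 0 le_rfl
    -- `k` is the derivative of `t ↦ h t / t` at `a`.
    set k := (deriv h a - h a / a) / a with hk
    have hka : k * a = deriv h a - h a / a := by rw [hk]; field_simp
    refine ⟨k, ?_, fun t ht => ?_⟩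
    · rw [hk]
      refine div_nonpos_of_nonpos_of_nonneg (sub_nonpos.2 ?_) ha.le
      rw [le_div_iff₀ ha]
      linarith
    · have := nonneg_of_hasDerivAt_of_convexOn (a := a) (t := t) ha
        (F := fun t => h t - (t * (h a / a) + k * (t * (t - a))))
        (F' := fun t => deriv h t - (h a / a + k * (2 * t - a)))
        (h_cont.sub (by fun_prop)) (fun t ht => ?_) ?_ (by simp [h_zero])
        (by field_simp; ring) (by linear_combination -hka) ht
      · linarith
      · refine (h_diff1 t ht).hasDerivAt.sub ?_
        have := ((hasDerivAt_id t).mul_const (h a / a)).add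
          (((hasDerivAt_id t).mul ((hasDerivAt_id t).sub_const a)).const_mul k)
        refine (this.congr_deriv ?_).congr_of_eventuallyEq (Eventually.of_forall fun x => ?_)
        · simp only [id]
          ring
        · simp [id]
      · have := hconv.add (f := deriv h)
          (g := fun t => (-2 * k) * t + (k * a - h a / a)) ⟨convex_Ioi 0, ?_⟩
        · refine this.congr fun t _ => ?_
          simp only [Pi.add_apply]
          ring
        · intro x _ y _ p q _ _ hpq
          simp only [smul_eq_mul]
          apply le_of_eq
          linear_combination (-(k * a - h a / a)) * hpq

namespace IsOscWeight

variable {h : ℝ → ℝ}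

theorem bijOn (hh : IsOscWeight h) : BijOn h (Ici 0) (Ici 0) := by
  refine ⟨fun t ht => ?_, hh.strictMonoOn.injOn, fun y hy => ?_⟩
  · have := hh.strictMonoOn.monotoneOn (mem_Ici.2 le_rfl) ht ht
    rwa [hh.map_zero] at this
  · obtain ⟨T, hT, hT'⟩ := ((hh.tendsto.eventually_ge_atTop y).and (eventually_ge_atTop 0)).exists
    have := intermediate_value_Icc hT' (hh.continuousOn.mono Icc_subset_Ici_self)
    obtain ⟨t, ht, rfl⟩ := this ⟨by rwa [hh.map_zero], hT⟩
    exact ⟨t, ht.1, rfl⟩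

theorem nonneg (hh : IsOscWeight h) {t : ℝ} (ht : 0 ≤ t) : 0 ≤ h t := hh.bijOn.mapsTo ht

theorem pos (hh : IsOscWeight h) {t : ℝ} (ht : 0 < t) : 0 < h t := by
  have := hh.strictMonoOn (mem_Ici.2 le_rfl) ht.le ht
  rwa [hh.map_zero] at this

theorem continuous_comp_abs (hh : IsOscWeight h) : Continuous fun t => h |t| :=
  hh.continuousOn.comp_continuous continuous_abs abs_nonneg

/-- `t ↦ h t / t` is nonincreasing, with the denominators cleared. -/
theorem mul_map_le_mul_map (hh : IsOscWeight h) {s t : ℝ} (hs : 0 ≤ s) (hst : s ≤ t) :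
    s * h t ≤ t * h s := by
  rcases hst.eq_or_lt with rfl | hlt
  · exact le_rfl
  have ht : 0 < t := hs.trans_lt hlt
  have := hh.concaveOn.2 (mem_Ici.2 le_rfl) (mem_Ici.2 ht.le)
    (sub_nonneg.2 ((div_le_one ht).2 hst)) (div_nonneg hs ht.le)
    (by ring)
  simp only [smul_eq_mul, mul_zero, zero_add, hh.map_zero, div_mul_cancel₀ _ ht.ne'] at this
  rw [div_mul_eq_mul_div, div_le_iff₀ ht] at this
  linarith

theorem halfLineInv_nonneg (hh : IsOscWeight h) {y : ℝ} (hy : 0 ≤ y) : 0 ≤ halfLineInv h y :=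
  Function.invFunOn_mem (hh.bijOn.surjOn hy)

theorem map_halfLineInv (hh : IsOscWeight h) {y : ℝ} (hy : 0 ≤ y) : h (halfLineInv h y) = y :=
  Function.invFunOn_eq (hh.bijOn.surjOn hy)

theorem le_halfLineInv (hh : IsOscWeight h) {s y : ℝ} (hs : 0 ≤ s) (hy : 0 ≤ y) (hsy : h s ≤ y) :
    s ≤ halfLineInv h y := by
  rwa [← hh.strictMonoOn.le_iff_le hs (hh.halfLineInv_nonneg hy), hh.map_halfLineInv hy]

theorem halfLineInv_le (hh : IsOscWeight h) {s y : ℝ} (hs : 0 ≤ s) (hy : 0 ≤ y) (hsy : y ≤ h s) :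
    halfLineInv h y ≤ s := by
  rwa [← hh.strictMonoOn.le_iff_le (hh.halfLineInv_nonneg hy) hs, hh.map_halfLineInv hy]

end IsOscWeight

/-! ### A locally convex function on the parabolic strip -/

/-- A minorant of the lower Bellman function. Its argument stands for `(⟨f⟩, ⟨f²⟩)`. On the triangle
`|x₁| ≤ δ`, `2 δ |x₁| ≤ x₂` (whose third side is an arc of `x₂ = x₁ ^ 2 + δ ^ 2`) it is `c x₂`; elsewhere it is linear in `(|x₁|, x₂)`, with slope
`k` in `x₂`. The coefficient of `|x₁|` makes the two formulas agree on the lines `x₂ = 2 δ |x₁|`,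
which are tangent to the parabola `x₂ = x₁ ^ 2 + δ ^ 2` at `|x₁| = δ`. -/
noncomputable def bellman (δ c k : ℝ) (x : ℝ × ℝ) : ℝ :=
  if |x.1| ≤ δ ∧ 2 * δ * |x.1| ≤ x.2 then c * x.2 else 2 * δ * (c - k) * |x.1| + k * x.2

theorem convexOn_wing {δ c k : ℝ} (hδ : 0 ≤ δ) (hck : k ≤ c) (S : Set (ℝ × ℝ)) (hS : Convex ℝ S) :
    ConvexOn ℝ S fun x : ℝ × ℝ => 2 * δ * (c - k) * |x.1| + k * x.2 := by
  refine ⟨hS, fun x _ y _ p q hp hq _ => ?_⟩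
  have hA : 0 ≤ 2 * δ * (c - k) := mul_nonneg (by positivity) (sub_nonneg.2 hck)
  have h1 : |p * x.1 + q * y.1| ≤ p * |x.1| + q * |y.1| := by
    refine (abs_add_le _ _).trans ?_
    rw [abs_mul, abs_mul, abs_of_nonneg hp, abs_of_nonneg hq]
  have h2 := mul_le_mul_of_nonneg_left h1 hA
  simp only [Prod.fst_add, Prod.smul_fst, Prod.snd_add, Prod.smul_snd, smul_eq_mul]
  linarith

/-- `bellman` is convex on the region below any tangent to the parabola `x₂ = x₁ ^ 2 + δ ^ 2`. If
the abscissa `u` of the point of tangency has `|u| ≤ δ`, points of this region above the lines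
`x₂ = 2 δ |x₁|` are in the triangle, and `bellman` is the maximum of its two formulas; if
`|u| > δ`, such points are outside the triangle, and only the second formula is in force. -/
theorem convexOn_bellman {δ c k : ℝ} (hδ : 0 < δ) (hck : k ≤ c) (u : ℝ) :
    ConvexOn ℝ {x : ℝ × ℝ | x.2 ≤ 2 * u * x.1 - u ^ 2 + δ ^ 2} (bellman δ c k) := by
  have hS : Convex ℝ {x : ℝ × ℝ | x.2 ≤ 2 * u * x.1 - u ^ 2 + δ ^ 2} := by
    intro x hx y hy p q hp hq hpq
    simp only [mem_ofPred_eq, Prod.fst_add, Prod.smul_fst, Prod.snd_add, Prod.smul_snd,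
      smul_eq_mul] at hx hy ⊢
    have e : 2 * u * (p * x.1 + q * y.1) - u ^ 2 + δ ^ 2
      = p * (2 * u * x.1 - u ^ 2 + δ ^ 2) + q * (2 * u * y.1 - u ^ 2 + δ ^ 2) := by
      linear_combination (u ^ 2 - δ ^ 2) * hpq
    rw [e]
    exact add_le_add (mul_le_mul_of_nonneg_left hx hp) (mul_le_mul_of_nonneg_left hy hq)
  have hw := convexOn_wing hδ.le hck _ hS
  have hux : ∀ x : ℝ × ℝ, u * x.1 ≤ |u| * |x.1| := fun x => by
    rw [← abs_mul]; exact le_abs_self _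
  rcases le_or_gt |u| δ with hu | hu
  · have hv : ConvexOn ℝ {x : ℝ × ℝ | x.2 ≤ 2 * u * x.1 - u ^ 2 + δ ^ 2} fun x => c * x.2 := by
      refine ⟨hS, fun x _ y _ p q _ _ _ => le_of_eq ?_⟩
      simp only [Prod.snd_add, Prod.smul_snd, smul_eq_mul]
      ring
    refine (hv.sup hw).congr fun x hx => ?_
    simp only [mem_ofPred_eq] at hx
    simp only [bellman, Pi.sup_apply]
    split_ifs with hx'
    · refine max_eq_left ?_
      nlinarith [mul_le_mul_of_nonneg_left hx'.2 (sub_nonneg.2 hck)]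
    · refine max_eq_right ?_
      have hle : x.2 ≤ 2 * δ * |x.1| := by
        by_contra! hlt
        have h1 : δ < |x.1| := by
          by_contra! h1
          exact hx' ⟨h1, hlt.le⟩
        have h3 := hux x
        nlinarith [sq_abs u, abs_nonneg u]
      nlinarith [mul_le_mul_of_nonneg_left hle (sub_nonneg.2 hck)]
  · refine hw.congr fun x hx => ?_
    simp only [mem_ofPred_eq] at hx
    simp only [bellman]
    split_ifs with hx'
    · have hle : x.2 ≤ 2 * δ * |x.1| := by
        by_contra! hlt
        have h3 := hux x
        have h4 := hx'.1
        nlinarith [sq_abs u, abs_nonneg u]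
      have : x.2 = 2 * δ * |x.1| := le_antisymm hle hx'.2
      linear_combination (k - c) * this
    · rfl

/-- One step of the Bellman induction. If `N` equally weighted points `(y, z)` above the parabola
`z = y ^ 2` have their mean within vertical distance `ε ^ 2` of it, then each of them lies below
the tangent to `x₂ = x₁ ^ 2 + N ε ^ 2` over the mean, where `bellman` is convex. -/
theorem bellman_average_le {ι : Type*} [Fintype ι] {N ε δ c k : ℝ} (hN : 0 < N)
    (hcard : (Fintype.card ι : ℝ) = N) (hδ : 0 < δ)
    (hδε : δ ^ 2 = N * ε ^ 2) (hck : k ≤ c) (y z : ι → ℝ) (hyz : ∀ i, y i ^ 2 ≤ z i)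
    (hvar : N⁻¹ * ∑ i, z i ≤ (N⁻¹ * ∑ i, y i) ^ 2 + ε ^ 2) :
    bellman δ c k (N⁻¹ * ∑ i, y i, N⁻¹ * ∑ i, z i) ≤ N⁻¹ * ∑ i, bellman δ c k (y i, z i) := by
  set u := N⁻¹ * ∑ i, y i with hu
  have hNu : N * u = ∑ i, y i := by rw [hu]; field_simp
  have hmem : ∀ i, (y i, z i) ∈ {x : ℝ × ℝ | x.2 ≤ 2 * u * x.1 - u ^ 2 + δ ^ 2} := by
    intro i
    -- Each `z j - 2 u y j + u ^ 2 ≥ (y j - u) ^ 2` is nonnegative, hence at most `N` times the mean.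
    have h1 : z i - 2 * u * y i + u ^ 2 ≤ ∑ j, (z j - 2 * u * y j + u ^ 2) := by
      refine Finset.single_le_sum (f := fun j => z j - 2 * u * y j + u ^ 2)
        (fun j _ => ?_) (Finset.mem_univ i)
      nlinarith [hyz j, sq_nonneg (y j - u)]
    have h2 : ∑ j, (z j - 2 * u * y j + u ^ 2) = N * (N⁻¹ * ∑ i, z i) - N * u ^ 2 := by
      rw [Finset.sum_add_distrib, Finset.sum_sub_distrib, ← Finset.mul_sum, Finset.sum_const,
        Finset.card_univ, nsmul_eq_mul, hcard, ← hNu]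
      field_simp
      ring
    have h3 := mul_le_mul_of_nonneg_left hvar hN.le
    simp only [mem_ofPred_eq]
    nlinarith
  have := (convexOn_bellman hδ hck u).map_sum_le (t := Finset.univ) (w := fun _ => N⁻¹)
    (p := fun i => (y i, z i)) (fun _ _ => by positivity)
    (by rw [Finset.sum_const, Finset.card_univ, nsmul_eq_mul, hcard, mul_inv_cancel₀ hN.ne'])
    (fun i _ => hmem i)
  simp only [← Finset.smul_sum, smul_eq_mul] at this
  have e : (u, N⁻¹ * ∑ i, z i) = N⁻¹ • ∑ i, (y i, z i) :=
    Prod.ext (by rw [Prod.smul_fst, Prod.fst_sum, smul_eq_mul])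
      (by rw [Prod.smul_snd, Prod.snd_sum, smul_eq_mul])
  rw [e, Finset.mul_sum]
  exact this

section Cubes

open ProbabilityTheory

variable {n : ℕ}

/-! ### Averages over cubes -/

theorem volume_cube (a : Fin n → ℝ) (l : ℝ) :
    volume (Icc a fun i => a i + l) = ENNReal.ofReal l ^ n := by
  simp [Real.volume_Icc_pi]

namespace IsCube

variable {J Q : Set (Fin n → ℝ)}

theorem volume_ne_zero (hJ : IsCube J) : volume J ≠ 0 := by
  obtain ⟨a, l, hl, rfl⟩ := hJ
  rw [volume_cube]
  exact pow_ne_zero _ (by simpa using hl)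

theorem volume_ne_top (hJ : IsCube J) : volume J ≠ ∞ := by
  obtain ⟨a, l, hl, rfl⟩ := hJ
  rw [volume_cube]
  exact ENNReal.pow_ne_top ENNReal.ofReal_ne_top

theorem measurableSet (hJ : IsCube J) : MeasurableSet J := by
  obtain ⟨a, l, hl, rfl⟩ := hJ
  exact measurableSet_Icc

theorem isProbabilityMeasure_cond (hJ : IsCube J) : IsProbabilityMeasure (volume[|J]) :=
  cond_isProbabilityMeasure_of_finite hJ.volume_ne_zero hJ.volume_ne_top

theorem ae_mem (hJ : IsCube J) : ∀ᵐ x ∂volume[|J], x ∈ J :=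
  ae_cond_mem hJ.measurableSet

theorem integrable_cond {f : (Fin n → ℝ) → ℝ} (hJ : IsCube J) (hJQ : J ⊆ Q)
    (hf : IntegrableOn f Q) : Integrable f (volume[|J]) :=
  Integrable.smul_measure (hf.mono_set hJQ) (ENNReal.inv_ne_top.2 hJ.volume_ne_zero)

end IsCube

theorem laverage_eq_lintegral_cond (J : Set (Fin n → ℝ)) (f : (Fin n → ℝ) → ℝ≥0∞) :
    ⨍⁻ x in J, f x ∂volume = ∫⁻ x, f x ∂volume[|J] := by
  rw [laverage_eq', Measure.restrict_apply_univ, ProbabilityTheory.cond]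

theorem average_eq_integral_cond (J : Set (Fin n → ℝ)) (f : (Fin n → ℝ) → ℝ) :
    ⨍ x in J, f x ∂volume = ∫ x, f x ∂volume[|J] := by
  rw [average_eq', Measure.restrict_apply_univ, ProbabilityTheory.cond]

theorem aestronglyMeasurable_cond {J Q : Set (Fin n → ℝ)} (hJQ : J ⊆ Q) {f : (Fin n → ℝ) → ℝ}
    (hf : AEStronglyMeasurable f (volume.restrict Q)) : AEStronglyMeasurable f (volume[|J]) :=
  (hf.mono_measure (Measure.restrict_mono_set _ hJQ)).smul_measure _

open Classical in
/-- The lower corner of the subcube, one of the `2 ^ n` obtained by halving all sides of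
`[a, a + l]`, that lies in the upper half in exactly the directions `i ∈ s`. -/
noncomputable def childCorner (a : Fin n → ℝ) (l : ℝ) (s : Set (Fin n)) : Fin n → ℝ :=
  fun i => if i ∈ s then a i + l / 2 else a i

theorem child_subset (a : Fin n → ℝ) {l : ℝ} (hl : 0 ≤ l) (s : Set (Fin n)) :
    (Icc (childCorner a l s) fun i => childCorner a l s i + l / 2) ⊆ Icc a fun i => a i + l := by
  refine Icc_subset_Icc (fun i => ?_) (fun i => ?_) <;> dsimp only [childCorner] <;>
    split_ifs <;> linarith

/-- The closed subcubes overlap only in null sets; they agree almost everywhere with the disjoint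
half-open boxes of `BoxIntegral.Box.splitCenterBox`. -/
theorem restrict_cube_eq_sum (a : Fin n → ℝ) {l : ℝ} (hl : 0 < l) :
    volume.restrict (Icc a fun i => a i + l) = ∑ s : Set (Fin n),
      volume.restrict (Icc (childCorner a l s) fun i => childCorner a l s i + l / 2) := by
  classical
  let I : BoxIntegral.Box (Fin n) := ⟨a, fun i => a i + l, fun i => by linarith⟩
  have hI : ∀ s : Set (Fin n), (I.splitCenterBox s : Set (Fin n → ℝ)) =ᵐ[volume]
      (Icc (childCorner a l s) fun i => childCorner a l s i + l / 2 : Set (Fin n → ℝ)) := by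
    intro s
    have h1 := (I.splitCenterBox s).coe_ae_eq_Icc
    rw [BoxIntegral.Box.Icc_def] at h1
    have e1 : (I.splitCenterBox s).lower = childCorner a l s := by
      ext i
      simp only [BoxIntegral.Box.splitCenterBox, Set.piecewise, childCorner, I]
      split_ifs <;> ring
    have e2 : (I.splitCenterBox s).upper = fun i => childCorner a l s i + l / 2 := by
      ext i
      simp only [BoxIntegral.Box.splitCenterBox, Set.piecewise, childCorner, I]
      split_ifs <;> ring
    rwa [e1, e2] at h1
  have h0 : (I : Set (Fin n → ℝ)) =ᵐ[volume] (Icc a fun i => a i + l : Set (Fin n → ℝ)) :=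
    I.coe_ae_eq_Icc
  rw [← Measure.restrict_congr_set h0, ← I.iUnion_coe_splitCenterBox,
    Measure.restrict_iUnion (fun s t hst => I.disjoint_splitCenterBox hst)
      (fun s => (I.splitCenterBox s).measurableSet_coe), Measure.sum_fintype]
  exact Finset.sum_congr rfl fun s _ => Measure.restrict_congr_set (hI s)

theorem cond_cube_eq_sum (a : Fin n → ℝ) {l : ℝ} (hl : 0 < l) :
    volume[|Icc a fun i => a i + l] = ((2 : ℝ≥0∞) ^ n)⁻¹ • ∑ s : Set (Fin n),
      volume[|Icc (childCorner a l s) fun i => childCorner a l s i + l / 2] := by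
  simp only [ProbabilityTheory.cond, restrict_cube_eq_sum a hl, volume_cube]
  rw [← Finset.smul_sum, smul_smul]
  congr 1
  rw [← ENNReal.mul_inv (Or.inl (by simp)) (Or.inl (by simp)), ← mul_pow]
  congr 2
  rw [← ENNReal.ofReal_ofNat 2, ← ENNReal.ofReal_mul (by norm_num)]
  congr 1
  ring

theorem integral_cond_cube_eq_sum (a : Fin n → ℝ) {l : ℝ} (hl : 0 < l) {f : (Fin n → ℝ) → ℝ}
    (hf : IntegrableOn f (Icc a fun i => a i + l)) :
    ∫ x, f x ∂volume[|Icc a fun i => a i + l] = ((2 : ℝ) ^ n)⁻¹ * ∑ s : Set (Fin n),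
      ∫ x, f x ∂volume[|Icc (childCorner a l s) fun i => childCorner a l s i + l / 2] := by
  rw [cond_cube_eq_sum a hl, integral_smul_measure, integral_finsetSum_measure]
  · simp
  · exact fun s _ => IsCube.integrable_cond ⟨_, _, half_pos hl, rfl⟩ (child_subset a hl.le s) hf

/-! ### The Bellman induction -/

section Bounded

variable {h : ℝ → ℝ} {μ : Measure (Fin n → ℝ)} [IsFiniteMeasure μ] {f : (Fin n → ℝ) → ℝ} {N : ℝ}

theorem integrable_of_abs_le (hf : AEStronglyMeasurable f μ) (hN : ∀ x, |f x| ≤ N) :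
    Integrable f μ :=
  Integrable.of_bound hf N (Eventually.of_forall fun x => hN x)

theorem integrable_sq_of_abs_le (hf : AEStronglyMeasurable f μ) (hN : ∀ x, |f x| ≤ N) :
    Integrable (fun x => f x ^ 2) μ :=
  integrable_of_abs_le (N := N ^ 2) (hf.pow 2) fun x => by
    rw [abs_pow]
    exact pow_le_pow_left₀ (abs_nonneg _) (hN x) 2

theorem IsOscWeight.integrable_comp_abs (hh : IsOscWeight h) (hf : AEStronglyMeasurable f μ)
    (hN : ∀ x, |f x| ≤ N) : Integrable (fun x => h |f x|) μ :=
  integrable_of_abs_le (N := h N) (hh.continuous_comp_abs.comp_aestronglyMeasurable hf)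
    fun x => by
      rw [abs_of_nonneg (hh.nonneg (abs_nonneg _))]
      exact hh.strictMonoOn.monotoneOn (mem_Ici.2 (abs_nonneg _)) ((abs_nonneg _).trans (hN x)) (hN x)

end Bounded

/-- The lower bound `h |t| ≥ A |t| + k t ^ 2`, integrated. It holds for every `f`, with no control of
its oscillation. -/
theorem IsOscWeight.wing_le_integral {h : ℝ → ℝ} (hh : IsOscWeight h)
    {μ : Measure (Fin n → ℝ)} [IsProbabilityMeasure μ] {f : (Fin n → ℝ) → ℝ} {N : ℝ}
    (hf : AEStronglyMeasurable f μ) (hN : ∀ x, |f x| ≤ N) {a k : ℝ} (ha : 0 < a) (hk : k ≤ 0)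
    (hquad : ∀ t, 0 ≤ t → t * (h a / a) + k * (t * (t - a)) ≤ h t) :
    (h a / a - k * a) * |∫ x, f x ∂μ| + k * ∫ x, f x ^ 2 ∂μ ≤ ∫ x, h |f x| ∂μ := by
  have i1 := (integrable_of_abs_le hf hN).abs
  have i2 := integrable_sq_of_abs_le hf hN
  have hA : 0 ≤ h a / a - k * a := by
    have := div_nonneg (hh.nonneg ha.le) ha.le
    nlinarith
  calc (h a / a - k * a) * |∫ x, f x ∂μ| + k * ∫ x, f x ^ 2 ∂μ
      ≤ (h a / a - k * a) * ∫ x, |f x| ∂μ + k * ∫ x, f x ^ 2 ∂μ := by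
        gcongr
        exact abs_integral_le_integral_abs
    _ = ∫ x, (h a / a - k * a) * |f x| + k * f x ^ 2 ∂μ := by
        rw [integral_add (i1.const_mul _) (i2.const_mul _), integral_const_mul, integral_const_mul]
    _ ≤ ∫ x, h |f x| ∂μ := by
        refine integral_mono ((i1.const_mul _).add (i2.const_mul _))
          (hh.integrable_comp_abs hf hN) fun x => ?_
        have := hquad |f x| (abs_nonneg _)
        have e := sq_abs (f x)
        simp only
        nlinarith

theorem sq_integral_le_integral_sq {μ : Measure (Fin n → ℝ)} [IsProbabilityMeasure μ]
    {f : (Fin n → ℝ) → ℝ} (h1 : MemLp f 2 μ) :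
    (∫ x, f x ∂μ) ^ 2 ≤ ∫ x, f x ^ 2 ∂μ := by
  have := variance_nonneg f μ
  rw [variance_eq_sub h1] at this
  simpa using this

/-- The Bellman inequality, up to an error controlled by an approximation `ψ` of `f`, on cubes so
small that `ψ` is nearly constant. Either the error term alone beats `c N ^ 2`, or `|ψ| ≤ 3 δ / 2`
on the cube; in the latter case the inequality holds pointwise, because `c t ^ 2 ≤ h |t|` for
`|t| ≤ 2 δ`, while `|f - ψ| ≥ δ / 2` where `|f| > 2 δ`. -/
theorem IsOscWeight.bellman_le_integral_add_of_small {h : ℝ → ℝ} (hh : IsOscWeight h)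
    {J : Set (Fin n → ℝ)} (hJ : IsCube J)
    {f ψ : (Fin n → ℝ) → ℝ} {N δ k : ℝ} (hf : AEStronglyMeasurable f (volume[|J]))
    (hN : ∀ x, |f x| ≤ N) (hδ : 0 < δ) (hk : k ≤ 0)
    (hquad : ∀ t, 0 ≤ t → t * (h (2 * δ) / (2 * δ)) + k * (t * (t - 2 * δ)) ≤ h t)
    (hψ : Integrable ψ (volume[|J])) (hosc : ∀ x ∈ J, ∀ y ∈ J, |ψ x - ψ y| ≤ δ / 4) :
    bellman δ (h (2 * δ) / (4 * δ ^ 2)) k (∫ x, f x ∂volume[|J], ∫ x, f x ^ 2 ∂volume[|J]) ≤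
      ∫ x, h |f x| ∂volume[|J] +
        4 * (h (2 * δ) / (4 * δ ^ 2)) * N ^ 2 / δ * ∫ x, |f x - ψ x| ∂volume[|J] := by
  have := hJ.isProbabilityMeasure_cond
  have hc : 0 < h (2 * δ) / (4 * δ ^ 2) := div_pos (hh.pos (by positivity)) (by positivity)
  have hcd : h (2 * δ) / (2 * δ) = 2 * δ * (h (2 * δ) / (4 * δ ^ 2)) := by field_simp; ring
  have hch : h (2 * δ) / (4 * δ ^ 2) * (4 * δ ^ 2) = h (2 * δ) := by field_simp
  set c := h (2 * δ) / (4 * δ ^ 2) with hc_def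
  have i1 := integrable_of_abs_le hf hN
  have i2 := integrable_sq_of_abs_le hf hN
  have ih := hh.integrable_comp_abs hf hN
  have ie : Integrable (fun x => |f x - ψ x|) (volume[|J]) := (i1.sub hψ).abs
  have h0 : 0 ≤ ∫ x, h |f x| ∂volume[|J] := integral_nonneg fun x => hh.nonneg (abs_nonneg _)
  have he : 0 ≤ ∫ x, |f x - ψ x| ∂volume[|J] := integral_nonneg fun x => abs_nonneg _
  have hN2 : ∀ x, f x ^ 2 ≤ N ^ 2 := fun x => sq_le_sq' (abs_le.1 (hN x)).1 (abs_le.1 (hN x)).2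
  have hM : 0 ≤ 4 * c * N ^ 2 / δ := by positivity
  rw [bellman]
  split_ifs with hx
  · simp only at hx ⊢
    rcases le_or_gt (c * N ^ 2) (4 * c * N ^ 2 / δ * ∫ x, |f x - ψ x| ∂volume[|J]) with hle | hlt
    · have : ∫ x, f x ^ 2 ∂volume[|J] ≤ N ^ 2 := by
        refine (integral_mono i2 (integrable_const (N ^ 2)) hN2).trans ?_
        simp
      nlinarith
    · have hsmall : ∫ x, |f x - ψ x| ∂volume[|J] < δ / 4 := by
        by_contra! hge
        have := mul_le_mul_of_nonneg_left hge hM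
        have e : 4 * c * N ^ 2 / δ * (δ / 4) = c * N ^ 2 := by field_simp
        linarith
      have hψ1 : |∫ x, ψ x ∂volume[|J]| ≤ δ + δ / 4 := by
        have e : ∫ x, ψ x ∂volume[|J] =
            ∫ x, f x ∂volume[|J] - ∫ x, (f x - ψ x) ∂volume[|J] := by
          rw [integral_sub i1 hψ]; ring
        have h3 : |∫ x, (f x - ψ x) ∂volume[|J]| ≤ _ := abs_integral_le_integral_abs
        rw [e]
        refine (abs_sub _ _).trans ?_
        linarith [hx.1]
      have hψ2 : ∀ y ∈ J, |ψ y| ≤ 3 * δ / 2 := by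
        intro y hy
        have e : ψ y - ∫ x, ψ x ∂volume[|J] = ∫ x, (ψ y - ψ x) ∂volume[|J] := by
          rw [integral_sub (integrable_const _) hψ]; simp
        have h3 : |ψ y - ∫ x, ψ x ∂volume[|J]| ≤ δ / 4 := by
          rw [e]
          have := norm_integral_le_of_norm_le_const (μ := volume[|J]) (f := fun x => ψ y - ψ x)
            (C := δ / 4) (hJ.ae_mem.mono fun x hx => hosc y hy x hx)
          simpa using this
        have h4 := abs_sub_abs_le_abs_sub (ψ y) (∫ x, ψ x ∂volume[|J])
        linarith
      rw [← integral_const_mul, ← integral_const_mul, ← integral_add ih (ie.const_mul _)]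
      refine integral_mono_ae (i2.const_mul _) (ih.add (ie.const_mul _)) ?_
      filter_upwards [hJ.ae_mem] with x hx
      have hx2 := hψ2 x hx
      rcases le_or_gt |f x| (2 * δ) with hfx | hfx
      · have h3 := hh.mul_map_le_mul_map (abs_nonneg (f x)) hfx
        have h4 : c * f x ^ 2 ≤ h |f x| := by
          rw [← sq_abs, ← mul_le_mul_iff_of_pos_right (show (0 : ℝ) < 4 * δ ^ 2 by positivity)]
          calc c * |f x| ^ 2 * (4 * δ ^ 2) = |f x| * (|f x| * h (2 * δ)) := by rw [← hch]; ring
            _ ≤ |f x| * (2 * δ * h |f x|) := by gcongr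
            _ ≤ 2 * δ * (2 * δ * h |f x|) := by
                gcongr
                exact mul_nonneg (by positivity) (hh.nonneg (abs_nonneg _))
            _ = h |f x| * (4 * δ ^ 2) := by ring
        have h5 := mul_nonneg hM (abs_nonneg (f x - ψ x))
        linarith
      · have h3 : δ / 2 ≤ |f x - ψ x| := by
          have := abs_sub_abs_le_abs_sub (f x) (ψ x)
          linarith
        have h4 := mul_le_mul_of_nonneg_left h3 hM
        have e : 4 * c * N ^ 2 / δ * (δ / 2) = 2 * (c * N ^ 2) := by field_simp; ring
        have h5 := mul_le_mul_of_nonneg_left (hN2 x) hc.le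
        have h6 := hh.nonneg (abs_nonneg (f x))
        have h7 : 0 ≤ c * N ^ 2 := by positivity
        linarith
  · have := hh.wing_le_integral hf hN (by positivity) hk hquad
    rw [hcd] at this
    have h5 := mul_nonneg hM he
    simp only
    linarith

theorem memLp_two_of_abs_le {μ : Measure (Fin n → ℝ)} [IsFiniteMeasure μ]
    {f : (Fin n → ℝ) → ℝ} {N : ℝ} (hf : AEStronglyMeasurable f μ) (hN : ∀ x, |f x| ≤ N) :
    MemLp f 2 μ :=
  MemLp.of_bound hf N (Eventually.of_forall fun x => hN x)

/-- The Bellman inequality for bounded functions: `bellman` at `(⟨f⟩, ⟨f²⟩)` is at most `⟨h |f|⟩` if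
the variances of `f` over all subcubes are at most `ε ^ 2` and `δ = 2 ^ (n / 2) ε`. -/
theorem IsOscWeight.bellman_le_integral {h : ℝ → ℝ} (hh : IsOscWeight h)
    {Q : Set (Fin n → ℝ)} {f : (Fin n → ℝ) → ℝ} {N ε δ k : ℝ}
    (hf : AEStronglyMeasurable f (volume.restrict Q)) (hN : ∀ x, |f x| ≤ N)
    (hδ : 0 < δ) (hδε : δ ^ 2 = 2 ^ n * ε ^ 2) (hk : k ≤ 0)
    (hquad : ∀ t, 0 ≤ t → t * (h (2 * δ) / (2 * δ)) + k * (t * (t - 2 * δ)) ≤ h t)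
    (hvar : ∀ J, IsCube J → J ⊆ Q → Var[f; volume[|J]] ≤ ε ^ 2)
    {J : Set (Fin n → ℝ)} (hJ : IsCube J) (hJQ : J ⊆ Q) :
    bellman δ (h (2 * δ) / (4 * δ ^ 2)) k (∫ x, f x ∂volume[|J], ∫ x, f x ^ 2 ∂volume[|J]) ≤
      ∫ x, h |f x| ∂volume[|J] := by
  have hc : 0 ≤ h (2 * δ) / (4 * δ ^ 2) := div_nonneg (hh.nonneg (by positivity)) (by positivity)
  set c := h (2 * δ) / (4 * δ ^ 2) with hc_def
  have hM : 0 ≤ 4 * c * N ^ 2 / δ := by positivity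
  have key : ∀ ψ : (Fin n → ℝ) → ℝ, HasCompactSupport ψ → Continuous ψ →
      ∀ J, IsCube J → J ⊆ Q →
      bellman δ c k (∫ x, f x ∂volume[|J], ∫ x, f x ^ 2 ∂volume[|J]) ≤
        ∫ x, h |f x| ∂volume[|J] + 4 * c * N ^ 2 / δ * ∫ x, |f x - ψ x| ∂volume[|J] := by
    intro ψ hψs hψc
    have hψint : ∀ J : Set (Fin n → ℝ), IsCube J → IntegrableOn ψ J := by
      rintro _ ⟨a, l, hl, rfl⟩
      exact hψc.continuousOn.integrableOn_compact isCompact_Icc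
    obtain ⟨η, hη, hηψ⟩ := Metric.uniformContinuous_iff.1
      (hψc.uniformContinuous_of_tendsto_cocompact hψs.is_zero_at_infty) (δ / 4) (by positivity)
    -- Induction on the scale, from cubes of side at most `η / 2` upwards.
    have main : ∀ (m : ℕ) (a : Fin n → ℝ) (l : ℝ), 0 < l → l ≤ 2 ^ m * (η / 2) →
        (Icc a fun i => a i + l) ⊆ Q →
        bellman δ c k (∫ x, f x ∂volume[|Icc a fun i => a i + l],
          ∫ x, f x ^ 2 ∂volume[|Icc a fun i => a i + l]) ≤
        ∫ x, h |f x| ∂volume[|Icc a fun i => a i + l] +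
          4 * c * N ^ 2 / δ * ∫ x, |f x - ψ x| ∂volume[|Icc a fun i => a i + l] := by
      intro m
      induction m with
      | zero =>
        intro a l hl hlη hJQ
        have hJ : IsCube (Icc a fun i => a i + l) := ⟨a, l, hl, rfl⟩
        refine hh.bellman_le_integral_add_of_small hJ (aestronglyMeasurable_cond hJQ hf) hN hδ hk
          hquad (hJ.integrable_cond subset_rfl (hψint _ hJ)) fun x hx y hy => ?_
        refine (hηψ (lt_of_le_of_lt ((dist_pi_le_iff hl.le).2 fun i => ?_)
          (show l < η by rw [pow_zero, one_mul] at hlη; linarith))).le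
        rw [Real.dist_eq, abs_le]
        have h1 := hx.1 i
        have h2 := hx.2 i
        have h3 := hy.1 i
        have h4 := hy.2 i
        simp only at h2 h4
        constructor <;> linarith
      | succ m ih =>
        intro a l hl hlη hJQ
        have hJ : IsCube (Icc a fun i => a i + l) := ⟨a, l, hl, rfl⟩
        have hfin : IsFiniteMeasure (volume.restrict (Icc a fun i => a i + l)) :=
          ⟨by rw [Measure.restrict_apply_univ]; exact hJ.volume_ne_top.lt_top⟩
        have hfJ : AEStronglyMeasurable f (volume.restrict (Icc a fun i => a i + l)) :=
          hf.mono_measure (Measure.restrict_mono_set _ hJQ)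
        have i1 := integrable_of_abs_le hfJ hN
        have hchild : ∀ s : Set (Fin n),
            IsCube (Icc (childCorner a l s) fun i => childCorner a l s i + l / 2) :=
          fun s => ⟨_, _, half_pos hl, rfl⟩
        have hchildQ : ∀ s, (Icc (childCorner a l s) fun i => childCorner a l s i + l / 2) ⊆ Q :=
          fun s => (child_subset a hl.le s).trans hJQ
        have hv := hvar _ hJ hJQ
        have := hJ.isProbabilityMeasure_cond
        rw [variance_eq_sub (memLp_two_of_abs_le (aestronglyMeasurable_cond hJQ hf) hN)] at hv
        simp only [Pi.pow_apply] at hv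
        rw [integral_cond_cube_eq_sum a hl i1,
          integral_cond_cube_eq_sum a hl (integrable_sq_of_abs_le hfJ hN)] at hv ⊢
        rw [integral_cond_cube_eq_sum a hl (hh.integrable_comp_abs hfJ hN),
          integral_cond_cube_eq_sum a hl (f := fun x => |f x - ψ x|)
            (i1.sub (hψint _ hJ)).abs]
        refine (bellman_average_le (N := 2 ^ n) (ε := ε) (by positivity) ?_ hδ hδε
          (hk.trans hc) _ _ (fun s => ?_) (by linarith)).trans ?_
        · rw [Fintype.card_set, Fintype.card_fin]
          push_cast
          rfl
        · have := (hchild s).isProbabilityMeasure_cond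
          exact sq_integral_le_integral_sq
            (memLp_two_of_abs_le (aestronglyMeasurable_cond (hchildQ s) hf) hN)
        · rw [mul_left_comm, ← mul_add]
          refine mul_le_mul_of_nonneg_left ?_ (by positivity)
          rw [Finset.mul_sum, ← Finset.sum_add_distrib]
          refine Finset.sum_le_sum fun s _ => ?_
          refine ih _ _ (half_pos hl) ?_ (hchildQ s)
          rw [pow_succ] at hlη
          linarith
    rintro _ ⟨a, l, hl, rfl⟩ hJQ
    obtain ⟨m, hm⟩ := pow_unbounded_of_one_lt (l / (η / 2)) (one_lt_two (α := ℝ))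
    exact main m a l hl ((div_lt_iff₀ (by positivity)).1 hm).le hJQ
  have := hJ.isProbabilityMeasure_cond
  have hreg : (volume[|J]).Regular :=
    Measure.Regular.smul (ENNReal.inv_ne_top.2 hJ.volume_ne_zero)
  -- The error constant does not depend on `ψ`, so the error vanishes as `ψ` approaches `f` in `L¹`.
  refine le_of_forall_pos_le_add fun e he => ?_
  obtain ⟨ψ, hψs, hψle, hψc, -⟩ :=
    (integrable_of_abs_le (aestronglyMeasurable_cond hJQ hf)
      hN).exists_hasCompactSupport_integral_sub_le (ε := e / (4 * c * N ^ 2 / δ + 1)) (by positivity)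
  refine (key ψ hψs hψc J hJ hJQ).trans ?_
  gcongr
  simp only [Real.norm_eq_abs] at hψle
  refine (mul_le_mul_of_nonneg_left hψle hM).trans ?_
  rw [mul_div_assoc', div_le_iff₀ (by positivity)]
  nlinarith

/-- The function `f` need not have mean zero on `J`. If its mean is large and `(⟨f⟩, ⟨f²⟩)` lies
above the lines `x₂ = 2 δ |x₁|`, the quadratic lower bound for `h` at `⟨f²⟩ / |⟨f⟩|` suffices;
otherwise the Bellman inequality applies. -/
theorem IsOscWeight.mul_variance_le_integral {h : ℝ → ℝ} (hh : IsOscWeight h)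
    {Q : Set (Fin n → ℝ)} {f : (Fin n → ℝ) → ℝ} {N ε δ : ℝ}
    (hf : AEStronglyMeasurable f (volume.restrict Q)) (hN : ∀ x, |f x| ≤ N)
    (hδ : 0 < δ) (hδε : δ ^ 2 = 2 ^ n * ε ^ 2)
    (hvar : ∀ J, IsCube J → J ⊆ Q → Var[f; volume[|J]] ≤ ε ^ 2)
    {J : Set (Fin n → ℝ)} (hJ : IsCube J) (hJQ : J ⊆ Q) :
    h (2 * δ) / (4 * δ ^ 2) * Var[f; volume[|J]] ≤ ∫ x, h |f x| ∂volume[|J] := by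
  have hc : 0 ≤ h (2 * δ) / (4 * δ ^ 2) := div_nonneg (hh.nonneg (by positivity)) (by positivity)
  have := hJ.isProbabilityMeasure_cond
  have hfJ := aestronglyMeasurable_cond hJQ hf
  have hv := hvar J hJ hJQ
  have hεδ : ε ^ 2 ≤ δ ^ 2 := by
    rw [hδε]
    exact le_mul_of_one_le_left (sq_nonneg _) (one_le_pow₀ one_le_two)
  have hve : Var[f; volume[|J]] = ∫ x, f x ^ 2 ∂volume[|J] - (∫ x, f x ∂volume[|J]) ^ 2 :=
    variance_eq_sub (memLp_two_of_abs_le hfJ hN)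
  set v := Var[f; volume[|J]]
  set u := ∫ x, f x ∂volume[|J] with hu
  set w := ∫ x, f x ^ 2 ∂volume[|J] with hw
  have hcd : h (2 * δ) / (4 * δ ^ 2) * (4 * δ ^ 2) = h (2 * δ) := by field_simp
  set c := h (2 * δ) / (4 * δ ^ 2) with hc_def
  by_cases hcase : δ < |u| ∧ 2 * δ * |u| < w
  · obtain ⟨h1, h2⟩ := hcase
    have hu0 : 0 < |u| := hδ.trans h1
    have hw0 : 0 < w := lt_trans (by positivity) h2
    have ha : 2 * δ < w / |u| := by rwa [lt_div_iff₀ hu0]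
    have ha0 : 0 < w / |u| := lt_trans (by positivity) ha
    obtain ⟨k, hk, hquad⟩ := hh.exists_quadratic_le _ ha0
    have h3 := hh.wing_le_integral hfJ hN ha0 hk hquad
    have h4 : h (2 * δ) ≤ h (w / |u|) :=
      hh.strictMonoOn.monotoneOn (mem_Ici.2 (by positivity)) ha0.le ha.le
    have h5 : (h (w / |u|) / (w / |u|) - k * (w / |u|)) * |u| + k * w =
        h (w / |u|) * (u ^ 2 / w) := by
      rw [← sq_abs u]
      field_simp
      ring
    rw [← hu, ← hw, h5] at h3
    have h6 : 1 / 2 ≤ u ^ 2 / w := by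
      rw [div_le_div_iff₀ two_pos hw0]
      nlinarith [sq_abs u]
    have h7 : 0 ≤ h (2 * δ) := hh.nonneg (by positivity)
    have h8 : h (2 * δ) * (1 / 2) ≤ h (w / |u|) * (u ^ 2 / w) :=
      mul_le_mul h4 h6 (by norm_num) (h7.trans h4)
    have h9 : c * v ≤ c * δ ^ 2 := mul_le_mul_of_nonneg_left (hv.trans hεδ) hc
    linarith
  · obtain ⟨k, hk, hquad⟩ := hh.exists_quadratic_le (2 * δ) (by positivity)
    have h3 := hh.bellman_le_integral hf hN hδ hδε hk hquad hvar hJ hJQ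
    refine le_trans ?_ h3
    have h4 : c * v ≤ c * w := by
      rw [hve]
      exact mul_le_mul_of_nonneg_left (by linarith [sq_nonneg u]) hc
    refine h4.trans ?_
    rw [bellman, ← hu, ← hw, ← hc_def]
    simp only
    split_ifs with hx
    · exact le_rfl
    · have h5 : w ≤ 2 * δ * |u| := by
        by_contra! h6
        exact hcase ⟨lt_of_not_ge fun h7 => hx ⟨h7, h6.le⟩, h6⟩
      nlinarith [mul_le_mul_of_nonneg_left h5 (sub_nonneg.2 (hk.trans hc))]

/-! ### Truncation and the two estimates -/

theorem bmoNorm_le_iff {Q : Set (Fin n → ℝ)} {φ : (Fin n → ℝ) → ℝ} {b : ℝ≥0∞} :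
    bmoNorm Q φ ≤ b ↔ ∀ J, IsCube J → J ⊆ Q →
      ∫⁻ x, ENNReal.ofReal (|φ x - ∫ y, φ y ∂volume[|J]| ^ 2) ∂volume[|J] ≤ b ^ 2 := by
  simp only [bmoNorm, iSup_le_iff, laverage_eq_lintegral_cond, average_eq_integral_cond, one_div]
  refine forall_congr' fun J => forall_congr' fun _ => forall_congr' fun _ => ?_
  rw [ENNReal.rpow_inv_le_iff two_pos]
  norm_cast

theorem weakOsc_le_iff {h : ℝ → ℝ} {Q : Set (Fin n → ℝ)} {φ : (Fin n → ℝ) → ℝ} {b : ℝ≥0∞} :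
    weakOsc h Q φ ≤ b ↔ ∀ J, IsCube J → J ⊆ Q →
      ∫⁻ x, ENNReal.ofReal (h |φ x - ∫ y, φ y ∂volume[|J]|) ∂volume[|J] ≤ b := by
  simp only [weakOsc, iSup_le_iff, laverage_eq_lintegral_cond, average_eq_integral_cond]

theorem lintegral_sq_eq_ofReal_variance {μ : Measure (Fin n → ℝ)} [IsProbabilityMeasure μ]
    {f : (Fin n → ℝ) → ℝ} (hf : MemLp f 2 μ) :
    ∫⁻ x, ENNReal.ofReal (|f x - ∫ y, f y ∂μ| ^ 2) ∂μ = ENNReal.ofReal (Var[f; μ]) := by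
  rw [hf.ofReal_variance_eq, evariance]
  refine lintegral_congr fun x => ?_
  rw [ENNReal.ofReal_pow (abs_nonneg _), Real.enorm_eq_ofReal_abs]

/-- The truncation of `t` to the interval `[-N, N]` (for `N ≥ 0`). -/
def truncate (N t : ℝ) : ℝ := max (-N) (min N t)

theorem continuous_truncate (N : ℝ) : Continuous (truncate N) := by
  unfold truncate
  fun_prop

theorem abs_truncate_le {N : ℝ} (hN : 0 ≤ N) (t : ℝ) : |truncate N t| ≤ N :=
  abs_le.2 ⟨le_max_left _ _, max_le (by linarith) (min_le_left _ _)⟩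

theorem truncate_of_abs_le {N t : ℝ} (ht : |t| ≤ N) : truncate N t = t := by
  rw [truncate, min_eq_right (abs_le.1 ht).2, max_eq_right (abs_le.1 ht).1]

theorem abs_truncate_sub_truncate_le (N s t : ℝ) : |truncate N s - truncate N t| ≤ |s - t| := by
  refine (abs_max_sub_max_le_max _ _ _ _).trans ?_
  simp only [sub_self, abs_zero, abs_nonneg, sup_of_le_right]
  refine (abs_min_sub_min_le_max _ _ _ _).trans ?_
  simp

theorem abs_truncate_le_abs {N : ℝ} (hN : 0 ≤ N) (t : ℝ) : |truncate N t| ≤ |t| := by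
  have := abs_truncate_sub_truncate_le N t 0
  rwa [truncate_of_abs_le (t := 0) (by simpa using hN), sub_zero, sub_zero] at this

theorem tendsto_truncate (t : ℝ) : Tendsto (fun N : ℕ => truncate N t) atTop (𝓝 t) := by
  refine tendsto_const_nhds.congr' ?_
  filter_upwards [eventually_ge_atTop ⌈|t|⌉₊] with N hN
  exact (truncate_of_abs_le (Nat.ceil_le.1 hN)).symm

theorem bmoNorm_truncate_ne_top {Q : Set (Fin n → ℝ)} {φ : (Fin n → ℝ) → ℝ} {N : ℝ} (hN : 0 ≤ N) :
    bmoNorm Q (fun x => truncate N (φ x)) ≠ ∞ := by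
  refine ne_top_of_le_ne_top (ENNReal.ofReal_ne_top (r := 2 * N)) (bmoNorm_le_iff.2 ?_)
  intro J hJ _
  have := hJ.isProbabilityMeasure_cond
  have h1 : |∫ y, truncate N (φ y) ∂volume[|J]| ≤ N := by
    have := norm_integral_le_of_norm_le_const (μ := volume[|J]) (C := N)
      (f := fun x => truncate N (φ x)) (Eventually.of_forall fun x => abs_truncate_le hN (φ x))
    simpa using this
  refine (lintegral_mono fun x => ENNReal.ofReal_le_ofReal (pow_le_pow_left₀ (abs_nonneg _)
    (show _ ≤ 2 * N from ?_) 2)).trans ?_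
  · refine (abs_sub _ _).trans ?_
    linarith [abs_truncate_le hN (φ x)]
  · rw [lintegral_const, measure_univ, mul_one, ENNReal.ofReal_pow (by linarith)]

/-- The upper estimate for truncations of `φ`. Averages over `J` of the truncated function are
compared with the truncation of `⟨φ⟩_J`, not with its own average, so that the oscillation is
pointwise at most that of `φ`; this is why the variance estimate is needed without the assumption
of mean zero. -/
theorem IsOscWeight.map_bmoNorm_truncate_le {h : ℝ → ℝ} (hh : IsOscWeight h)
    {Q : Set (Fin n → ℝ)} {φ : (Fin n → ℝ) → ℝ} (hφ : IntegrableOn φ Q) {K : ℝ} (hK0 : 0 ≤ K)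
    (hK : weakOsc h Q φ ≤ ENNReal.ofReal K) {N : ℝ} (hN : 0 ≤ N) :
    h (2 * (√(2 ^ n) * (bmoNorm Q fun x => truncate N (φ x)).toReal)) ≤ 2 ^ (n + 2) * K := by
  have htop := bmoNorm_truncate_ne_top (Q := Q) (φ := φ) hN
  have hφN : AEStronglyMeasurable (fun x => truncate N (φ x)) (volume.restrict Q) :=
    (continuous_truncate N).comp_aestronglyMeasurable hφ.aestronglyMeasurable
  set ε := (bmoNorm Q fun x => truncate N (φ x)).toReal with hε
  have hεe : (bmoNorm Q fun x => truncate N (φ x)) = ENNReal.ofReal ε :=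
    (ENNReal.ofReal_toReal htop).symm
  have hε0 : 0 ≤ ε := ENNReal.toReal_nonneg
  rcases hε0.eq_or_lt with h0 | hpos
  · rw [← h0, mul_zero, mul_zero, hh.map_zero]
    positivity
  have hs : 0 < √((2 : ℝ) ^ n) := Real.sqrt_pos.2 (by positivity)
  set δ := √(2 ^ n) * ε with hδ_def
  have hδ : 0 < δ := mul_pos hs hpos
  have hδε : δ ^ 2 = 2 ^ n * ε ^ 2 := by rw [hδ_def, mul_pow, Real.sq_sqrt (by positivity)]
  have hvar : ∀ J, IsCube J → J ⊆ Q →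
      Var[fun x => truncate N (φ x); volume[|J]] ≤ ε ^ 2 := by
    intro J hJ hJQ
    have := hJ.isProbabilityMeasure_cond
    have h1 := bmoNorm_le_iff.1 hεe.le J hJ hJQ
    rw [lintegral_sq_eq_ofReal_variance (memLp_two_of_abs_le (aestronglyMeasurable_cond hJQ hφN)
      fun x => abs_truncate_le hN _), ← ENNReal.ofReal_pow hε0] at h1
    exact (ENNReal.ofReal_le_ofReal_iff (by positivity)).1 h1
  have hc : 0 < h (2 * δ) / (4 * δ ^ 2) := div_pos (hh.pos (by positivity)) (by positivity)
  have hcK : ∀ J, IsCube J → J ⊆ Q →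
      h (2 * δ) / (4 * δ ^ 2) * Var[fun x => truncate N (φ x); volume[|J]] ≤ K := by
    intro J hJ hJQ
    have := hJ.isProbabilityMeasure_cond
    set m := ∫ x, φ x ∂volume[|J]
    have hf : AEStronglyMeasurable (fun x => truncate N (φ x) - truncate N m)
        (volume.restrict Q) := hφN.sub aestronglyMeasurable_const
    have hfN : ∀ x, |truncate N (φ x) - truncate N m| ≤ 2 * N := fun x =>
      (abs_sub _ _).trans (by linarith [abs_truncate_le hN (φ x), abs_truncate_le hN m])
    have hve : ∀ J, IsCube J → J ⊆ Q →
        Var[fun x => truncate N (φ x) - truncate N m; volume[|J]] =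
          Var[fun x => truncate N (φ x); volume[|J]] := by
      intro J hJ hJQ
      have := hJ.isProbabilityMeasure_cond
      exact variance_sub_const (aestronglyMeasurable_cond hJQ hφN) _
    have h1 := hh.mul_variance_le_integral hf hfN hδ hδε
      (fun J hJ hJQ => (hve J hJ hJQ).trans_le (hvar J hJ hJQ)) hJ hJQ
    rw [hve J hJ hJQ] at h1
    refine h1.trans ?_
    rw [integral_eq_lintegral_of_nonneg_ae
      (Eventually.of_forall fun x => hh.nonneg (abs_nonneg _))
      (hh.continuous_comp_abs.comp_aestronglyMeasurable (aestronglyMeasurable_cond hJQ hf))]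
    refine ENNReal.toReal_le_of_le_ofReal hK0 (le_trans (lintegral_mono fun x => ?_)
      (weakOsc_le_iff.1 hK J hJ hJQ))
    exact ENNReal.ofReal_le_ofReal (hh.strictMonoOn.monotoneOn (mem_Ici.2 (abs_nonneg _))
      (mem_Ici.2 (abs_nonneg _)) (abs_truncate_sub_truncate_le _ _ _))
  -- The supremum over `J` of the variances is `ε ^ 2` itself, so the bound passes to `ε`.
  have hle : ε ≤ √(K / (h (2 * δ) / (4 * δ ^ 2))) := by
    refine ENNReal.toReal_le_of_le_ofReal (Real.sqrt_nonneg _) (bmoNorm_le_iff.2 ?_)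
    intro J hJ hJQ
    have := hJ.isProbabilityMeasure_cond
    rw [lintegral_sq_eq_ofReal_variance (memLp_two_of_abs_le (aestronglyMeasurable_cond hJQ hφN)
      fun x => abs_truncate_le hN _), ← ENNReal.ofReal_pow (Real.sqrt_nonneg _),
      Real.sq_sqrt (by positivity)]
    refine ENNReal.ofReal_le_ofReal ?_
    rw [le_div_iff₀ hc, mul_comm]
    exact hcK J hJ hJQ
  rw [Real.le_sqrt hε0 (by positivity), le_div_iff₀ hc, hδε, mul_div_assoc', div_le_iff₀
    (by positivity)] at hle
  have : ε ^ 2 * h (2 * δ) ≤ ε ^ 2 * (2 ^ (n + 2) * K) := by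
    refine hle.trans (le_of_eq ?_)
    ring
  exact le_of_mul_le_mul_left this (by positivity)

/-- Fatou's lemma on each subcube. -/
theorem bmoNorm_le_of_truncate {Q : Set (Fin n → ℝ)} {φ : (Fin n → ℝ) → ℝ}
    (hφ : IntegrableOn φ Q) {b : ℝ≥0∞}
    (hb : ∀ N : ℕ, (bmoNorm Q fun x => truncate N (φ x)) ≤ b) : bmoNorm Q φ ≤ b := by
  refine bmoNorm_le_iff.2 fun J hJ hJQ => ?_
  have := hJ.isProbabilityMeasure_cond
  have hφJ := hJ.integrable_cond hJQ hφ
  have hm : ∀ N : ℕ, AEStronglyMeasurable (fun x => truncate N (φ x)) (volume[|J]) := fun N =>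
    (continuous_truncate N).comp_aestronglyMeasurable hφJ.aestronglyMeasurable
  have hlim : Tendsto (fun N : ℕ => ∫ x, truncate N (φ x) ∂volume[|J]) atTop
      (𝓝 (∫ x, φ x ∂volume[|J])) :=
    tendsto_integral_of_dominated_convergence (fun x => |φ x|) hm hφJ.abs
      (fun N => Eventually.of_forall fun x => abs_truncate_le_abs N.cast_nonneg _)
      (Eventually.of_forall fun x => tendsto_truncate _)
  have hpt : ∀ x, Tendsto (fun N : ℕ => ENNReal.ofReal
      (|truncate N (φ x) - ∫ y, truncate N (φ y) ∂volume[|J]| ^ 2)) atTop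
      (𝓝 (ENNReal.ofReal (|φ x - ∫ y, φ y ∂volume[|J]| ^ 2))) := fun x =>
    ENNReal.tendsto_ofReal ((((tendsto_truncate _).sub hlim).abs).pow 2)
  calc ∫⁻ x, ENNReal.ofReal (|φ x - ∫ y, φ y ∂volume[|J]| ^ 2) ∂volume[|J]
      = ∫⁻ x, liminf (fun N : ℕ => ENNReal.ofReal
          (|truncate N (φ x) - ∫ y, truncate N (φ y) ∂volume[|J]| ^ 2)) atTop ∂volume[|J] :=
        lintegral_congr fun x => (hpt x).liminf_eq.symm
    _ ≤ liminf (fun N : ℕ => ∫⁻ x, ENNReal.ofReal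
          (|truncate N (φ x) - ∫ y, truncate N (φ y) ∂volume[|J]| ^ 2) ∂volume[|J]) atTop :=
        lintegral_liminf_le' fun N => by
          have := (hm N).aemeasurable
          fun_prop
    _ ≤ b ^ 2 := by
        refine liminf_le_of_le (by isBoundedDefault) fun c hc => ?_
        obtain ⟨N, hN⟩ := hc.exists
        exact hN.trans (bmoNorm_le_iff.1 (hb N) J hJ hJQ)

theorem memBMO_of_bmoNorm_lt_top {Q : Set (Fin n → ℝ)} {φ : (Fin n → ℝ) → ℝ}
    (hφ : IntegrableOn φ Q) (hb : bmoNorm Q φ < ∞) : MemBMO Q φ := by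
  refine ⟨hφ, lt_of_le_of_lt (b := 1 + bmoNorm Q φ ^ 2) ?_
    (ENNReal.add_lt_top.2 ⟨ENNReal.one_lt_top, ENNReal.pow_lt_top hb⟩)⟩
  simp only [iSup_le_iff, laverage_eq_lintegral_cond, average_eq_integral_cond]
  intro J hJ hJQ
  have := hJ.isProbabilityMeasure_cond
  calc ∫⁻ x, ENNReal.ofReal |φ x - ∫ y, φ y ∂volume[|J]| ∂volume[|J]
      ≤ ∫⁻ x, (1 + ENNReal.ofReal (|φ x - ∫ y, φ y ∂volume[|J]| ^ 2)) ∂volume[|J] := by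
        refine lintegral_mono fun x => ?_
        rw [← ENNReal.ofReal_one, ← ENNReal.ofReal_add zero_le_one (by positivity)]
        refine ENNReal.ofReal_le_ofReal ?_
        nlinarith [sq_nonneg (|φ x - ∫ y, φ y ∂volume[|J]| - 1)]
    _ ≤ 1 + bmoNorm Q φ ^ 2 := by
        rw [lintegral_add_left measurable_const, lintegral_const, measure_univ, one_mul]
        gcongr
        exact bmoNorm_le_iff.1 le_rfl J hJ hJQ

/-- Jensen's inequality for the concave function `s ↦ h (√s)`, with the tangent line of `h` at a
point `s` above the norm and the bound `2 s t ≤ t ^ 2 + s ^ 2`. -/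
theorem IsOscWeight.weakOsc_le {h : ℝ → ℝ} (hh : IsOscWeight h)
    {Q : Set (Fin n → ℝ)} {φ : (Fin n → ℝ) → ℝ} (hb : bmoNorm Q φ < ∞) :
    weakOsc h Q φ ≤ ENNReal.ofReal (h (bmoNorm Q φ).toReal) := by
  set σ := (bmoNorm Q φ).toReal with hσ
  have hσ0 : 0 ≤ σ := ENNReal.toReal_nonneg
  have hσe : bmoNorm Q φ ≤ ENNReal.ofReal σ := (ENNReal.ofReal_toReal hb.ne).ge
  have key : ∀ s, σ < s → weakOsc h Q φ ≤ ENNReal.ofReal (h s) := by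
    intro s hs
    have hs0 : 0 < s := hσ0.trans_lt hs
    obtain ⟨m, hm, hms⟩ := hh.exists_le_affine s hs0
    have hp : 0 ≤ h s - m * s / 2 := by
      have h1 := hms 0 le_rfl
      have h2 := hh.nonneg hs0.le
      rw [hh.map_zero] at h1
      nlinarith
    refine weakOsc_le_iff.2 fun J hJ hJQ => ?_
    have := hJ.isProbabilityMeasure_cond
    calc ∫⁻ x, ENNReal.ofReal (h |φ x - ∫ y, φ y ∂volume[|J]|) ∂volume[|J]
        ≤ ∫⁻ x, (ENNReal.ofReal (h s - m * s / 2) + ENNReal.ofReal (m / (2 * s)) *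
            ENNReal.ofReal (|φ x - ∫ y, φ y ∂volume[|J]| ^ 2)) ∂volume[|J] := by
          refine lintegral_mono fun x => ?_
          rw [← ENNReal.ofReal_mul (by positivity), ← ENNReal.ofReal_add hp (by positivity)]
          refine ENNReal.ofReal_le_ofReal ?_
          set t := |φ x - ∫ y, φ y ∂volume[|J]|
          refine (hms t (abs_nonneg _)).trans ?_
          -- The tangent at `s` bounds `h t`, and `2 s t ≤ t ^ 2 + s ^ 2` makes the bound quadratic in `t`.
          have e : h s - m * s / 2 + m / (2 * s) * t ^ 2 - (h s + m * (t - s))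
              = m / (2 * s) * (t - s) ^ 2 := by
            field_simp
            ring
          have : 0 ≤ m / (2 * s) * (t - s) ^ 2 := by positivity
          linarith
      _ = ENNReal.ofReal (h s - m * s / 2) + ENNReal.ofReal (m / (2 * s)) *
            ∫⁻ x, ENNReal.ofReal (|φ x - ∫ y, φ y ∂volume[|J]| ^ 2) ∂volume[|J] := by
          rw [lintegral_add_left measurable_const, lintegral_const, measure_univ, mul_one,
            lintegral_const_mul' _ _ ENNReal.ofReal_ne_top]
      _ ≤ ENNReal.ofReal (h s - m * s / 2) + ENNReal.ofReal (m / (2 * s)) *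
            ENNReal.ofReal s ^ 2 := by
          gcongr
          refine (bmoNorm_le_iff.1 hσe J hJ hJQ).trans ?_
          gcongr
      _ = ENNReal.ofReal (h s) := by
          rw [← ENNReal.ofReal_pow hs0.le, ← ENNReal.ofReal_mul (by positivity),
            ← ENNReal.ofReal_add hp (by positivity)]
          congr 1
          field_simp
          ring
  have hlim : Tendsto (fun s => ENNReal.ofReal (h s)) (𝓝[>] σ) (𝓝 (ENNReal.ofReal (h σ))) :=
    ENNReal.tendsto_ofReal ((hh.continuousOn σ hσ0).tendsto.mono_left
      (nhdsWithin_mono _ fun s hs => hσ0.trans (le_of_lt hs)))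
  exact ge_of_tendsto hlim (eventually_mem_nhdsWithin.mono fun s hs => key s hs)

end Cubes

theorem two_rpow_eq (n : ℕ) : (2 : ℝ) ^ (-(n : ℝ) / 2 - 1) = (2 * √(2 ^ n))⁻¹ := by
  rw [Real.sqrt_eq_rpow, ← Real.rpow_natCast 2 n, ← Real.rpow_mul two_pos.le,
    ← Real.rpow_one_add' two_pos.le (by positivity), ← Real.rpow_neg two_pos.le]
  congr 1
  ring

theorem theorem1 (n : ℕ) (h : ℝ → ℝ)
    (h_cont : ContinuousOn h (Set.Ici 0))
    (h_diff1 : ∀ t : ℝ, 0 < t → DifferentiableAt ℝ h t)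
    (h_diff2 : ∀ t : ℝ, 0 < t → DifferentiableAt ℝ (deriv h) t)
    (h_diff3 : ∀ t : ℝ, 0 < t → DifferentiableAt ℝ (deriv (deriv h)) t)
    (h_zero : h 0 = 0)
    (h_lim : Tendsto h atTop atTop)
    (h_deriv1 : ∀ t : ℝ, 0 < t → 0 < deriv h t)
    (h_deriv2 : ∀ t : ℝ, 0 < t → deriv (deriv h) t < 0)
    (h_deriv3 : ∀ t : ℝ, 0 < t → 0 < deriv (deriv (deriv h)) t)
    (Q : Set (Fin n → ℝ)) (hQ : IsCube Q)
    (φ : (Fin n → ℝ) → ℝ) (hφ : IntegrableOn φ Q)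
    (hK : weakOsc h Q φ < ∞) :
    Set.BijOn h (Set.Ici 0) (Set.Ici 0) ∧
    MemBMO Q φ ∧
    bmoNorm Q φ < ∞ ∧
    halfLineInv h (weakOsc h Q φ).toReal ≤ (bmoNorm Q φ).toReal ∧
    (bmoNorm Q φ).toReal ≤
      (2 : ℝ) ^ (-(n : ℝ) / 2 - 1) *
        halfLineInv h ((2 : ℝ) ^ (n + 2) * (weakOsc h Q φ).toReal) := by
  have hh : IsOscWeight h := isOscWeight_of_deriv h_cont h_diff1 h_diff2 h_diff3 h_zero h_lim
    h_deriv1 h_deriv2 h_deriv3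
  have hK0 : 0 ≤ (weakOsc h Q φ).toReal := ENNReal.toReal_nonneg
  have hKe : weakOsc h Q φ ≤ ENNReal.ofReal (weakOsc h Q φ).toReal :=
    (ENNReal.ofReal_toReal hK.ne).ge
  have hKn : 0 ≤ (2 : ℝ) ^ (n + 2) * (weakOsc h Q φ).toReal := by positivity
  have hs : 0 < √((2 : ℝ) ^ n) := Real.sqrt_pos.2 (by positivity)
  have hB0 : 0 ≤ (2 : ℝ) ^ (-(n : ℝ) / 2 - 1) *
      halfLineInv h ((2 : ℝ) ^ (n + 2) * (weakOsc h Q φ).toReal) :=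
    mul_nonneg (by positivity) (hh.halfLineInv_nonneg hKn)
  have hle : bmoNorm Q φ ≤ ENNReal.ofReal ((2 : ℝ) ^ (-(n : ℝ) / 2 - 1) *
      halfLineInv h ((2 : ℝ) ^ (n + 2) * (weakOsc h Q φ).toReal)) := by
    refine bmoNorm_le_of_truncate hφ fun N => ?_
    rw [ENNReal.le_ofReal_iff_toReal_le (bmoNorm_truncate_ne_top N.cast_nonneg) hB0, two_rpow_eq,
      inv_mul_eq_div, le_div_iff₀ (by positivity), mul_comm, mul_assoc]
    exact hh.le_halfLineInv (by positivity) hKn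
      (hh.map_bmoNorm_truncate_le hφ hK0 hKe N.cast_nonneg)
  have hlt : bmoNorm Q φ < ∞ := hle.trans_lt ENNReal.ofReal_lt_top
  refine ⟨hh.bijOn, memBMO_of_bmoNorm_lt_top hφ hlt, hlt, ?_,
    ENNReal.toReal_le_of_le_ofReal hB0 hle⟩
  exact hh.halfLineInv_le ENNReal.toReal_nonneg hK0
    (ENNReal.toReal_le_of_le_ofReal (hh.nonneg ENNReal.toReal_nonneg) (hh.weakOsc_le hlt))
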